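/- Let $R$ be a finite ring with identity (not necessarily commutative) that is Frobenius, i.e. $R$ is self-injective (as a left module) and $R/J(R)$ is isomorphic, as a left $R$-module, to the left socle of $R$, where $J(R)$ is the Jacobson radical. (1) Let $K$ be a field whose characteristic does not divide the characteristic of $R$ (a condition that holds automatically if $K$ has characteristic $0$), and let $KR$ be the monoid algebra over $K$ of the multiplicative monoid of $R$. Then $KR$ is a Frobenius algebra: it is a finite dimensional unital $K$-algebra, and there is a linear map $\lambda\colon KR\to K$ (a Frobenius form) such that the bilinear form $(a,b)\mapsto\lambda(ab)$ is nondegenerate. (2) Suppose in addition that $K$ is algebraically closed. Let $\widehat R_K=\mathrm{Hom}((R,+),K^\times)$ be the group of additive characters of $R$ over $K$, with the $R$-$R$-bimodule structure $(r\chi)(x)=\chi(xr)$, $(\chi r)(x)=\chi(rx)$. Then there is an additive character that generates $\widehat R_K$ both as a left and as a right $R$-module, and the $K$-linear extension to $KR$ of any character $\lambda\in\widehat R_K$ that generates $\widehat R_K$ as a left or as a right $R$-module is a Frobenius form on $KR$. (3) The semigroup determinant of the multiplicative monoid of $R$, that is, the determinant of the $R\times R$ matrix over the polynomial ring $\mathbb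 C[x_r\mid r\in R]$ whose $(r,s)$-entry is the variable $x_{rs}$, is a nonzero polynomial. -/

import Mathlib

/-- The left socle of a ring `R`: the sum of all simple (minimal) left ideals of `R`. -/
def leftSocle (R : Type*) [Ring R] : Ideal R :=
  sSup {I : Ideal R | IsSimpleModule R I}

/-- The condition defining (finite) Frobenius rings: `R` is (left) self-injective, and
`R / J(R)` is isomorphic to the left socle of `R` as a left `R`-module. -/
def IsFrobeniusRing (R : Type*) [Ring R] : Prop :=
  Module.Injective R R ∧ Nonempty ((R ⧸ Ring.jacobson R) ≃ₗ[R] leftSocle R)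

/-- A linear functional `f` on a `K`-algebra `A` is a Frobenius form if the bilinear form
`(a, b) ↦ f (a * b)` is nondegenerate (on both sides). -/
def IsFrobeniusForm {K A : Type*} [Field K] [Ring A] [Algebra K A] (f : A →ₗ[K] K) : Prop :=
  ((LinearMap.mul K A).compr₂ f).Nondegenerate

/-- A Frobenius algebra: a finite dimensional unital `K`-algebra with a Frobenius form. -/
def IsFrobeniusAlgebra (K A : Type*) [Field K] [Ring A] [Algebra K A] : Prop :=
  FiniteDimensional K A ∧ ∃ f : A →ₗ[K] K, IsFrobeniusForm f

/-- The left action of `r : R` on additive characters of `R` with values in `K` (which are the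
homomorphisms from the additive group of `R` to `Kˣ`): `(r χ) x = χ (x * r)`. -/
def leftAct {R K : Type*} [Ring R] [Field K] (r : R) (χ : AddChar R K) : AddChar R K :=
  χ.compAddMonoidHom (AddMonoidHom.mulRight r)

/-- The right action of `r : R` on additive characters of `R` with values in `K`:
`(χ r) x = χ (r * x)`. -/
def rightAct {R K : Type*} [Ring R] [Field K] (χ : AddChar R K) (r : R) : AddChar R K :=
  χ.compAddMonoidHom (AddMonoidHom.mulLeft r)

/-- `χ` generates the group of additive characters `R → Kˣ` as a left `R`-module: every
character is of the form `r χ`. -/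
def IsLeftGenerating {R K : Type*} [Ring R] [Field K] (χ : AddChar R K) : Prop :=
  ∀ ψ : AddChar R K, ∃ r : R, leftAct r χ = ψ

/-- `χ` generates the group of additive characters `R → Kˣ` as a right `R`-module: every
character is of the form `χ r`. -/
def IsRightGenerating {R K : Type*} [Ring R] [Field K] (χ : AddChar R K) : Prop :=
  ∀ ψ : AddChar R K, ∃ r : R, rightAct χ r = ψ

/-- The `K`-linear extension of an additive character `χ : R → Kˣ` to the monoid algebra `KR` of
the multiplicative monoid of `R`. -/
noncomputable def charLinearExtension {R K : Type*} [Ring R] [Field K] (χ : AddChar R K) :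
    MonoidAlgebra K R →ₗ[K] K :=
  (MonoidAlgebra.basis R K).constr K (fun r : R => χ r)

/-- The Cayley table of a semigroup `S`: the `S × S` matrix with entry `x_{st}` at `(s, t)`, over
the complex polynomial ring in variables `x_s`, `s ∈ S`. -/
noncomputable def cayleyTable (S : Type*) [Semigroup S] : Matrix S S (MvPolynomial S ℂ) :=
  Matrix.of fun s t => MvPolynomial.X (s * t)

/-- The (Dedekind–Frobenius) semigroup determinant of a finite semigroup `S`. -/
noncomputable def semigroupDet (S : Type*) [Semigroup S] [Fintype S] [DecidableEq S] :
    MvPolynomial S ℂ :=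
  (cayleyTable S).det

/-!
Everything rests on an additive character `χ` of `R`, with values in a field `L` containing enough
roots of unity, whose kernel contains no nonzero left ideal.

*Existence* (`IsFrobeniusRing.exists_isLeftGenerating`). Every nonzero left ideal of the finite ring
`R` meets the left socle, so it is enough to find such a character on the left socle and to extend
it to `(R, +)`. The socle is isomorphic to the semisimple ring `R / J(R)`, which by
Wedderburn–Artin is a product of matrix rings over finite division rings; there the product of
nontrivial characters evaluated at the traces works.

*Generation* (`isLeftGenerating_iff_isRightGenerating`). Having no nonzero left ideal in the kernel
means that `r ↦ r χ` is injective, hence surjective, since `R` and its character group have the same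
cardinality. If `χ` generates on the left and is trivial on a right ideal `x R`, then every
character is trivial at `x`, so `x = 0`; thus `r ↦ χ r` is injective as well, and the two notions of
generation coincide.

*Nondegeneracy* (`det_addChar_ne_zero`). The rows of the matrix `(χ (r s))` are the distinct
characters `χ r`, which are linearly independent, so the determinant is nonzero. This determinant is
the discriminant of the bilinear form attached to `χ`, and for `L = ℂ` it is a value of the semigroup
determinant.

*Arbitrary fields* (`det_trace_mul_addChar_ne_zero`). For a general `K` take `L = K(ζ_n)` with `n` the
characteristic of `R`, and let `a` generate a normal basis of `L / K`. Then `x ↦ Tr (a χ(x))` gives a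
Frobenius form over `K`. Indeed, for `τ` in the Galois group, `τ ∘ χ` is again a character, hence
equal to `t χ` for some `t : R`. If `y ∈ KR` is orthogonal to everything, then
`Tr (a τ(χ(y s))) = Tr (a χ(y s t)) = 0` for all `s` and `τ`, and moving `τ` to the other factor shows
that `χ(y s)` is orthogonal to the whole normal basis, hence zero.
-/

/-! ### Characters of finite abelian groups -/

section Characters

variable {G L : Type*} [AddCommGroup G] [Field L]

lemma exponent_multiplicative_dvd {n : ℕ} (hn : ∀ g : G, n • g = 0) :
    Monoid.exponent (Multiplicative G) ∣ n :=
  Monoid.exponent_dvd_of_forall_pow_eq_one fun g => congrArg Multiplicative.ofAdd (hn g.toAdd)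

variable [Finite G]

lemma exists_addChar_apply_ne_one {n : ℕ} [NeZero n] [HasEnoughRootsOfUnity L n]
    (hn : ∀ g : G, n • g = 0) {g : G} (hg : g ≠ 0) : ∃ ψ : AddChar G L, ψ g ≠ 1 := by
  have := HasEnoughRootsOfUnity.of_dvd L (exponent_multiplicative_dvd hn)
  obtain ⟨φ, hφ⟩ := CommGroup.exists_apply_ne_one_of_hasEnoughRootsOfUnity (Multiplicative G) L
    (a := Multiplicative.ofAdd g) (by simpa using hg)
  refine ⟨AddChar.toMonoidHomEquiv.symm ((Units.coeHom L).comp φ), ?_⟩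
  simpa using hφ

lemma exists_addChar_extending {n : ℕ} [NeZero n] [HasEnoughRootsOfUnity L n]
    (hn : ∀ g : G, n • g = 0) (H : AddSubgroup G) (ψ : AddChar H L) :
    ∃ χ : AddChar G L, ∀ h : H, χ h = ψ h := by
  have := HasEnoughRootsOfUnity.of_dvd L (exponent_multiplicative_dvd hn)
  let ψ' : AddSubgroup.toSubgroup H →* Lˣ := MonoidHom.toHomUnits
    { toFun := fun h => ψ ⟨h.1.toAdd, h.2⟩
      map_one' := ψ.map_zero_eq_one
      map_mul' := fun a b => ψ.map_add_eq_mul ⟨a.1.toAdd, a.2⟩ ⟨b.1.toAdd, b.2⟩ }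
  obtain ⟨φ, hφ⟩ := MonoidHom.domRestrict_surjective (M := L) (AddSubgroup.toSubgroup H) ψ'
  refine ⟨AddChar.toMonoidHomEquiv.symm ((Units.coeHom L).comp φ), fun h => ?_⟩
  exact congrArg Units.val (DFunLike.congr_fun hφ ⟨Multiplicative.ofAdd h.1, h.2⟩)

lemma card_addChar {n : ℕ} [NeZero n] [HasEnoughRootsOfUnity L n]
    (hn : ∀ g : G, n • g = 0) : Nat.card (AddChar G L) = Nat.card G := by
  have := HasEnoughRootsOfUnity.of_dvd L (exponent_multiplicative_dvd hn)
  rw [Nat.card_congr (Multiplicative.ofAdd (α := G)),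
    ← CommGroup.card_monoidHom_of_hasEnoughRootsOfUnity (Multiplicative G) L]
  refine Nat.card_congr (AddChar.toMonoidHomEquiv.trans ⟨MonoidHom.toHomUnits,
    fun φ => (Units.coeHom L).comp φ, fun φ => ?_, fun φ => ?_⟩) <;> ext <;> simp

end Characters

/-! ### Characters of finite semisimple rings -/

/-- The character is the product over the factors of a nontrivial character of `D i` evaluated at
the trace: multiplying a nonzero `x` by a suitable matrix unit produces an element of trace `1` in
one factor and `0` in the others. -/
lemma exists_addChar_pi_matrix {L ι : Type*} [Field L] [Fintype ι] {n : ℕ} [NeZero n]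
    [HasEnoughRootsOfUnity L n] (d : ι → ℕ) (D : ι → Type*) [∀ i, DivisionRing (D i)]
    [∀ i, Finite (D i)] (hn : ∀ i, (n : D i) = 0) :
    ∃ ψ : AddChar (∀ i, Matrix (Fin (d i)) (Fin (d i)) (D i)) L,
      ∀ x, (∀ t, ψ (t * x) = 1) → x = 0 := by
  classical
  have hex : ∀ i, ∃ ψ : AddChar (D i) L, ψ 1 ≠ 1 := fun i =>
    exists_addChar_apply_ne_one (n := n) (fun g => by simp [nsmul_eq_mul, hn]) one_ne_zero
  choose ψ hψ using hex
  refine ⟨∏ i, (ψ i).compAddMonoidHom ((Matrix.traceAddMonoidHom (Fin (d i)) (D i)).comp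
    (Pi.evalAddMonoidHom _ i)), fun x hx => ?_⟩
  by_contra h
  obtain ⟨i, hi⟩ := Function.ne_iff.mp h
  obtain ⟨j, k, hjk⟩ : ∃ j k, x i j k ≠ 0 := by
    by_contra! h0
    exact hi (Matrix.ext h0)
  refine hψ i ?_
  have h1 := hx (Pi.single i (Matrix.single k j (x i j k)⁻¹))
  rw [AddChar.prod_apply, Finset.prod_eq_single i] at h1
  · simpa [Matrix.trace_single_mul, hjk] using h1
  · intro l _ hl
    simp [Pi.single_eq_of_ne hl]
  · simp

lemma exists_addChar_of_isSemisimpleRing {L T : Type*} [Field L] [Ring T] [Finite T]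
    [IsSemisimpleRing T] {n : ℕ} [NeZero n] [HasEnoughRootsOfUnity L n] (hn : (n : T) = 0) :
    ∃ ψ : AddChar T L, ∀ x, (∀ t, ψ (t * x) = 1) → x = 0 := by
  obtain ⟨m, D, d, _, _, hd, ⟨e⟩⟩ :=
    IsSemisimpleRing.exists_algEquiv_pi_matrix_divisionRing ℤ T
  -- `D i` embeds in `T` as scalar matrices in the `i`-th factor, hence is finite.
  have hinj : ∀ i, Function.Injective fun c : D i =>
      e.symm (Pi.single i (Matrix.scalar (Fin (d i)) c)) := fun i a b hab =>
    Matrix.scalar_inj.mp (Pi.single_injective i (e.symm.injective hab))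
  have hfin : ∀ i, Finite (D i) := fun i => Finite.of_injective _ (hinj i)
  have hn' : ∀ i, (n : D i) = 0 := fun i => by
    have h := congrFun (map_natCast e n) i
    rw [hn, map_zero, Pi.zero_apply] at h
    rw [Pi.natCast_apply, ← map_natCast (Matrix.scalar (Fin (d i)))] at h
    exact Matrix.scalar_inj.mp (h.symm.trans (map_zero (Matrix.scalar (Fin (d i)))).symm)
  obtain ⟨ψ, hψ⟩ := exists_addChar_pi_matrix (L := L) d D hn'
  refine ⟨ψ.compAddMonoidHom (e : T →+ _), fun x hx => ?_⟩
  refine (map_eq_zero_iff e e.injective).mp (hψ _ fun t => ?_)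
  simpa using hx (e.symm t)

/-! ### Generating characters -/

section Generating

variable {R L : Type*} [Ring R] [Field L]

@[simp] lemma leftAct_apply (r : R) (χ : AddChar R L) (x : R) : leftAct r χ x = χ (x * r) := rfl

@[simp] lemma rightAct_apply (r : R) (χ : AddChar R L) (x : R) : rightAct χ r x = χ (r * x) := rfl

lemma leftAct_injective {χ : AddChar R L} (h : ∀ x, (∀ t, χ (t * x) = 1) → x = 0) :
    Function.Injective fun r => leftAct r χ := fun a b hab => by
  refine sub_eq_zero.mp (h _ fun t => ?_)
  have := DFunLike.congr_fun hab t
  simp only [leftAct_apply] at this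
  rw [mul_sub, AddChar.map_sub_eq_div, this, div_self (χ.val_isUnit _).ne_zero]

lemma rightAct_injective {χ : AddChar R L} (h : ∀ x, (∀ t, χ (x * t) = 1) → x = 0) :
    Function.Injective (rightAct χ) := fun a b hab => by
  refine sub_eq_zero.mp (h _ fun t => ?_)
  have := DFunLike.congr_fun hab t
  simp only [rightAct_apply] at this
  rw [sub_mul, AddChar.map_sub_eq_div, this, div_self (χ.val_isUnit _).ne_zero]

variable [Finite R] {n : ℕ} [NeZero n] [HasEnoughRootsOfUnity L n]

/-- Valid because `R` has as many characters as elements. -/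
lemma surjective_of_injective_addChar (hn : (n : R) = 0) {f : R → AddChar R L}
    (hf : Function.Injective f) : Function.Surjective f := by
  have hcard : Nat.card (AddChar R L) = Nat.card R :=
    card_addChar (n := n) fun g => by rw [nsmul_eq_mul, hn, zero_mul]
  have : Finite (AddChar R L) := Nat.finite_of_card_ne_zero (hcard ▸ Nat.card_pos.ne')
  exact ((Nat.bijective_iff_injective_and_card f).mpr ⟨hf, hcard.symm⟩).2

lemma IsLeftGenerating.of_forall (hn : (n : R) = 0) {χ : AddChar R L}
    (h : ∀ x, (∀ t, χ (t * x) = 1) → x = 0) : IsLeftGenerating χ :=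
  surjective_of_injective_addChar hn (leftAct_injective h)

lemma IsRightGenerating.of_forall (hn : (n : R) = 0) {χ : AddChar R L}
    (h : ∀ x, (∀ t, χ (x * t) = 1) → x = 0) : IsRightGenerating χ :=
  surjective_of_injective_addChar hn (rightAct_injective h)

/-- Every character `r χ` is trivial at `x` if `χ` is trivial on `x R`, and characters separate the
points of `R`. -/
lemma IsLeftGenerating.eq_zero_of_forall (hn : (n : R) = 0) {χ : AddChar R L}
    (hχ : IsLeftGenerating χ) {x : R} (hx : ∀ t, χ (x * t) = 1) : x = 0 := by
  by_contra h
  obtain ⟨ψ, hψ⟩ := exists_addChar_apply_ne_one (L := L) (n := n)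
    (fun g : R => by rw [nsmul_eq_mul, hn, zero_mul]) h
  obtain ⟨r, rfl⟩ := hχ ψ
  exact hψ (hx r)

lemma IsRightGenerating.eq_zero_of_forall (hn : (n : R) = 0) {χ : AddChar R L}
    (hχ : IsRightGenerating χ) {x : R} (hx : ∀ t, χ (t * x) = 1) : x = 0 := by
  by_contra h
  obtain ⟨ψ, hψ⟩ := exists_addChar_apply_ne_one (L := L) (n := n)
    (fun g : R => by rw [nsmul_eq_mul, hn, zero_mul]) h
  obtain ⟨r, rfl⟩ := hχ ψ
  exact hψ (hx r)

lemma isLeftGenerating_iff_isRightGenerating (hn : (n : R) = 0) {χ : AddChar R L} :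
    IsLeftGenerating χ ↔ IsRightGenerating χ :=
  ⟨fun h => .of_forall hn fun _ => h.eq_zero_of_forall hn,
    fun h => .of_forall hn fun _ => h.eq_zero_of_forall hn⟩

/-- The left ideal generated by `x` contains a minimal left ideal, which lies in the left socle. -/
lemma exists_mem_leftSocle_of_forall {χ : AddChar R L} {x : R} (hx : x ≠ 0)
    (h : ∀ t, χ (t * x) = 1) : ∃ y ∈ leftSocle R, y ≠ 0 ∧ ∀ t, χ (t * y) = 1 := by
  obtain h0 | ⟨I, hI, hle⟩ := eq_bot_or_exists_atom_le (Ideal.span {x})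
  · exact absurd (Ideal.span_singleton_eq_bot.mp h0) hx
  · obtain ⟨y, hy, hy0⟩ := I.exists_mem_ne_zero_of_ne_bot hI.1
    refine ⟨y, le_sSup (a := I) (isSimpleModule_iff_isAtom.mpr hI) hy, hy0, fun t => ?_⟩
    obtain ⟨s, rfl⟩ := Ideal.mem_span_singleton'.mp (hle hy)
    rw [← mul_assoc, h]

/-- Transport a character of the semisimple ring `R / J(R)` without nonzero left ideals in its kernel
to the left socle, and extend it to `R`. -/
lemma IsFrobeniusRing.exists_isLeftGenerating (hR : IsFrobeniusRing R) (hn : (n : R) = 0) :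
    ∃ χ : AddChar R L, IsLeftGenerating χ := by
  obtain ⟨e⟩ := hR.2
  have : Finite (R ⧸ Ring.jacobson R) := Finite.of_surjective _ (Ideal.Quotient.mk_surjective)
  obtain ⟨ψ, hψ⟩ := exists_addChar_of_isSemisimpleRing (L := L) (T := R ⧸ Ring.jacobson R) (n := n)
    (by rw [← map_natCast (Ideal.Quotient.mk (Ring.jacobson R)), hn, map_zero])
  obtain ⟨χ, hχ⟩ := exists_addChar_extending (n := n)
    (fun g : R => by rw [nsmul_eq_mul, hn, zero_mul]) (leftSocle R).toAddSubgroup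
    (ψ.compAddMonoidHom (e.symm : leftSocle R →+ R ⧸ Ring.jacobson R))
  refine ⟨χ, .of_forall hn fun x hx => ?_⟩
  by_contra hx0
  obtain ⟨y, hy, hy0, h⟩ := exists_mem_leftSocle_of_forall hx0 hx
  refine hy0 (congrArg Subtype.val ((map_eq_zero_iff e.symm e.symm.injective).mp
    (hψ (e.symm ⟨y, hy⟩) fun t => ?_)))
  obtain ⟨t, rfl⟩ := Ideal.Quotient.mk_surjective t
  have h1 : Ideal.Quotient.mk (Ring.jacobson R) t * e.symm ⟨y, hy⟩
      = e.symm (t • ⟨y, hy⟩ : leftSocle R) := (map_smul e.symm t _).symm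
  rw [h1, ← h t]
  exact (hχ (t • ⟨y, hy⟩ : leftSocle R)).symm

end Generating

/-! ### Frobenius forms and determinants -/

section FrobeniusForm

variable {R K L : Type*} [Ring R] [Fintype R] [Field K] [Field L]

/-- Linear independence of the distinct characters `χ r`. -/
lemma eq_zero_of_sum_mul_addChar_eq_zero {χ : AddChar R L} (hχ : Function.Injective (rightAct χ))
    {v : R → L} (hv : ∀ s, ∑ r, v r * χ (r * s) = 0) : v = 0 := by
  have h := (linearIndependent_monoidHom (Multiplicative R) L).comp _
    (AddChar.toMonoidHomEquiv.injective.comp hχ)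
  refine funext (Fintype.linearIndependent_iff.mp h v (funext fun s => ?_))
  simpa using hv s.toAdd

variable [DecidableEq R]

/-- The matrix is the Gram matrix of the bilinear form in the basis `R` of `KR`. -/
lemma isFrobeniusForm_constr_iff (f : R → K) :
    IsFrobeniusForm ((MonoidAlgebra.basis R K).constr K f) ↔
      (Matrix.of fun r s => f (r * s)).det ≠ 0 := by
  rw [IsFrobeniusForm, LinearMap.nondegenerate_iff_det_ne_zero (MonoidAlgebra.basis R K)]
  have h : LinearMap.toMatrix₂ (MonoidAlgebra.basis R K) (MonoidAlgebra.basis R K)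
      ((LinearMap.mul K (MonoidAlgebra K R)).compr₂ ((MonoidAlgebra.basis R K).constr K f)) =
      Matrix.of fun r s => f (r * s) := by
    ext r s
    have := (MonoidAlgebra.basis R K).constr_basis K f (r * s)
    simp only [MonoidAlgebra.basis_apply] at this
    simpa [LinearMap.toMatrix₂_apply, MonoidAlgebra.single_mul_single] using this
  rw [h]

lemma det_mul_table_ne_zero {f : R → K}
    (h : ∀ v : R → K, (∀ s, ∑ r, v r * f (r * s) = 0) → v = 0) :
    (Matrix.of fun r s => f (r * s)).det ≠ 0 := fun h0 => by
  obtain ⟨v, hv, hv0⟩ := Matrix.exists_vecMul_eq_zero_iff.mpr h0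
  exact hv (h v fun s => congrFun hv0 s)

lemma det_addChar_ne_zero {χ : AddChar R L} (hχ : Function.Injective (rightAct χ)) :
    (Matrix.of fun r s => χ (r * s)).det ≠ 0 :=
  det_mul_table_ne_zero fun _ => eq_zero_of_sum_mul_addChar_eq_zero hχ

/-- Descent of the form given by `χ` from `L` to `K`, by means of the trace and a generator of a
normal basis. -/
lemma det_trace_mul_addChar_ne_zero [Algebra K L] [FiniteDimensional K L] [IsGalois K L]
    {χ : AddChar R L} (hχ : Function.Injective (rightAct χ)) (hl : IsLeftGenerating χ) :
    (Matrix.of fun r s =>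
      Algebra.trace K L (IsGalois.normalBasis K L 1 * χ (r * s))).det ≠ 0 := by
  refine det_mul_table_ne_zero (f := fun r => Algebra.trace K L (IsGalois.normalBasis K L 1 * χ r))
    fun v hv => ?_
  set a := IsGalois.normalBasis K L 1 with ha
  let F : R → L := fun s => ∑ r, algebraMap K L (v r) * χ (r * s)
  have htr : ∀ s, Algebra.trace K L (a * F s) = 0 := fun s => by
    rw [← hv s, Finset.mul_sum, map_sum]
    refine Finset.sum_congr rfl fun r _ => ?_
    rw [mul_left_comm, ← Algebra.smul_def, map_smul, smul_eq_mul]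
  -- Since `χ` generates, the twist `τ ∘ χ` is `t χ` for some `t`, so that `τ (F s) = F (s * t)`.
  have hτ : ∀ (τ : Gal(L/K)) s, Algebra.trace K L (a * τ (F s)) = 0 := fun τ s => by
    obtain ⟨t, ht⟩ := hl ((τ : L →* L).compAddChar χ)
    have ht' : ∀ x, χ (x * t) = τ (χ x) := DFunLike.congr_fun ht
    rw [← htr (s * t)]
    simp [F, ← mul_assoc, ht']
  -- By Galois invariance of the trace, `F s` is orthogonal to each conjugate of `a`.
  have hF : ∀ s, F s = 0 := fun s => by
    refine (traceForm_nondegenerate K L).1 _ fun y => ?_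
    refine LinearMap.congr_fun ((IsGalois.normalBasis K L).ext (f₂ := 0) fun τ => ?_) y
    rw [IsGalois.normalBasis_apply, ← ha, Algebra.traceForm_apply, LinearMap.zero_apply,
      ← hτ τ⁻¹ s, ← Algebra.trace_eq_of_algEquiv τ⁻¹, map_mul, mul_comm]
    simp
  have h0 := eq_zero_of_sum_mul_addChar_eq_zero hχ hF
  exact funext fun r => (map_eq_zero (algebraMap K L)).mp (congrFun h0 r)

lemma IsFrobeniusRing.isFrobeniusAlgebra (hR : IsFrobeniusRing R) {n : ℕ} [NeZero (n : K)]
    (hn : (n : R) = 0) : IsFrobeniusAlgebra K (MonoidAlgebra K R) := by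
  have : NeZero n := NeZero.of_neZero_natCast K
  let L := CyclotomicField n K
  have := IsCyclotomicExtension.isGalois {n} K L
  have := IsCyclotomicExtension.finiteDimensional {n} K L
  have : HasEnoughRootsOfUnity L n :=
    ⟨⟨_, IsCyclotomicExtension.zeta_spec n K L⟩, inferInstance⟩
  obtain ⟨χ, hχ⟩ := hR.exists_isLeftGenerating (L := L) hn
  exact ⟨Module.Finite.of_basis (MonoidAlgebra.basis R K), _, (isFrobeniusForm_constr_iff
    fun r => Algebra.trace K L (IsGalois.normalBasis K L 1 * χ r)).mpr
    (det_trace_mul_addChar_ne_zero (rightAct_injective fun _ => hχ.eq_zero_of_forall hn) hχ)⟩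

/-- The determinant of `(f (r * s))` is the value of the semigroup determinant at `f`. -/
lemma semigroupDet_ne_zero_of_det_ne_zero {f : R → ℂ}
    (h : (Matrix.of fun r s => f (r * s)).det ≠ 0) : semigroupDet R ≠ 0 := fun h0 => h <| by
  have := congrArg (MvPolynomial.eval f) h0
  rw [semigroupDet, RingHom.map_det, map_zero] at this
  rw [← this]
  congr 1
  ext r s
  simp [cayleyTable]

end FrobeniusForm

theorem theoremt (R : Type*) [Ring R] [Fintype R] [DecidableEq R]
    (hR : IsFrobeniusRing R) :
    (∀ (K : Type*) [Field K], ¬ ringChar K ∣ ringChar R →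
      IsFrobeniusAlgebra K (MonoidAlgebra K R) ∧
      (IsAlgClosed K →
        (∃ χ : AddChar R K, IsLeftGenerating χ ∧ IsRightGenerating χ) ∧
        ∀ χ : AddChar R K, IsLeftGenerating χ ∨ IsRightGenerating χ →
          IsFrobeniusForm (charLinearExtension χ))) ∧
    semigroupDet R ≠ 0 := by
  have hn : (ringChar R : R) = 0 := ringChar.Nat.cast_ringChar
  refine ⟨fun K _ hK => ?_, ?_⟩
  · have : NeZero (ringChar R : K) := ⟨fun h => hK ((ringChar.spec K _).mp h)⟩
    have : NeZero (ringChar R) := NeZero.of_neZero_natCast K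
    refine ⟨hR.isFrobeniusAlgebra hn, fun _ => ⟨?_, fun χ h => ?_⟩⟩
    · obtain ⟨χ, hχ⟩ := hR.exists_isLeftGenerating (L := K) hn
      exact ⟨χ, hχ, (isLeftGenerating_iff_isRightGenerating hn).mp hχ⟩
    · have hχ : IsLeftGenerating χ := h.elim id (isLeftGenerating_iff_isRightGenerating hn).mpr
      exact (isFrobeniusForm_constr_iff _).mpr
        (det_addChar_ne_zero (rightAct_injective fun _ => hχ.eq_zero_of_forall hn))
  · have : NeZero (ringChar R) := ⟨CharP.ringChar_ne_zero_of_finite R⟩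
    obtain ⟨χ, hχ⟩ := hR.exists_isLeftGenerating (L := ℂ) hn
    exact semigroupDet_ne_zero_of_det_ne_zero
      (det_addChar_ne_zero (rightAct_injective fun _ => hχ.eq_zero_of_forall hn))
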